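/- Let $\mathrm{Homeo}_+(\mathbb{R})$ be the group of orientation-preserving homeomorphisms of $\mathbb{R}$, with the $\sigma$-algebra generated by the evaluations $f\mapsto f(x)$, $x\in\mathbb{R}$ (the Borel $\sigma$-algebra of locally uniform convergence), and let $\mu$ be a probability measure on it (its support may be infinite). Let $g_1,g_2,\dots$ be i.i.d. with law $\mu$, let $F_n=g_n\circ\dots\circ g_1$, and put $$\phi_+(x)=\mathbb{P}\Big(\lim_{n\to\infty}F_n(x)=+\infty\Big),\qquad \phi_-(x)=\mathbb{P}\Big(\lim_{n\to\infty}F_n(x)=-\infty\Big),\qquad \phi_0(x)=1-\phi_+(x)-\phi_-(x).$$ Let $\hat\mu$ be the image of $\mu$ under $f\mapsto f^{-1}$, and let $\hat\phi_+,\hat\phi_-,\hat\phi_0$ be the corresponding functions for $\hat\mu$. Assume shiftability: for all $x,a\in\mathbb{R}$ there is $k\in\mathbb{N}$ such that the probabilities $\mathbb{P}(F_k(x)<x-a)$ and $\mathbb{P}(F_k(x)>x+a)$ are both non-zero. Then, possibly after interchanging $\mu$ and $\hat\mu$ and/or changing the coordinate by $x\mapsto -x$ (that is, replacing each map $f$ by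 $x\mapsto -f(-x)$), one of the following is true: 1. $\phi_+\equiv 1$ and $\hat\phi_-\equiv 1$; 2. $\phi_+\equiv 1$ and $\hat\phi_0\equiv 1$; 3. $\phi_0\equiv 1$ and $\hat\phi_0\equiv 1$; 4. $\phi_0\equiv 0$, neither $\phi_+$ nor $\phi_-$ is constant, and $\hat\phi_0\equiv 1$. -/

import Mathlib

open MeasureTheory Filter

namespace RDS

/-- The group of orientation-preserving homeomorphisms of the real line. An increasing bijection
of `ℝ` is the same thing as an orientation-preserving homeomorphism of `ℝ`. -/
abbrev HomeoPlus : Type := ℝ ≃o ℝ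

/-- The σ-algebra on the homeomorphism group generated by the evaluations `f ↦ f x`, `x ∈ ℝ`.
It is the Borel σ-algebra of the topology of locally uniform convergence. -/
instance : MeasurableSpace HomeoPlus :=
  ⨆ x : ℝ, MeasurableSpace.comap (fun f : HomeoPlus => f x) inferInstance

theorem measurable_eval (x : ℝ) : Measurable (fun f : HomeoPlus => f x) :=
  Measurable.of_comap_le
    (le_iSup (fun x : ℝ => MeasurableSpace.comap (fun f : HomeoPlus => f x) inferInstance) x)

theorem measurable_of_eval {α : Type*} [MeasurableSpace α] {g : α → HomeoPlus}
    (h : ∀ x : ℝ, Measurable (fun a => g a x)) : Measurable g := by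
  apply Measurable.of_le_map
  refine iSup_le fun x => ?_
  rw [MeasurableSpace.comap_le_iff_le_map, MeasurableSpace.map_comp]
  exact (h x).le_map

/-- The inverse map `f⁻¹`. -/
def inverseMap (f : HomeoPlus) : HomeoPlus := f.symm

theorem measurable_inverseMap : Measurable inverseMap := by
  refine measurable_of_eval fun x => measurable_of_Iic fun y => ?_
  have h : (fun f : HomeoPlus => inverseMap f x) ⁻¹' Set.Iic y
      = (fun f : HomeoPlus => f y) ⁻¹' Set.Ici x := by
    ext f
    exact f.symm_apply_le
  rw [h]
  exact measurable_eval y measurableSet_Ici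

/-- The map `f` written in the coordinate `-x`, i.e. `x ↦ -f(-x)`. -/
def reflectMap (f : HomeoPlus) : HomeoPlus where
  toFun x := -f (-x)
  invFun x := -f.symm (-x)
  left_inv x := by simp
  right_inv x := by simp
  map_rel_iff' := by simp

theorem measurable_reflectMap : Measurable reflectMap :=
  measurable_of_eval fun x => (measurable_eval (-x)).neg

/-- The measure defining the inverse dynamics: the image of `μ` when every map is replaced by its
inverse. -/
noncomputable def inverse (μ : ProbabilityMeasure HomeoPlus) : ProbabilityMeasure HomeoPlus :=
  μ.map measurable_inverseMap.aemeasurable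

/-- The measure defining the same dynamics after the change of coordinate `x ↦ -x`. -/
noncomputable def reflect (μ : ProbabilityMeasure HomeoPlus) : ProbabilityMeasure HomeoPlus :=
  μ.map measurable_reflectMap.aemeasurable

/-- The law on `Ω = HomeoPlus ^ ℕ` of an i.i.d. sequence of maps with distribution `μ`. -/
noncomputable def law (μ : ProbabilityMeasure HomeoPlus) : Measure (ℕ → HomeoPlus) :=
  Measure.infinitePi fun _ => (μ : Measure HomeoPlus)

/-- The iterations `F_n(x) = g_n ∘ ⋯ ∘ g_1 (x)`, where `g_{n+1}` is the coordinate `ω n`. -/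
def orbit (ω : ℕ → HomeoPlus) (x : ℝ) : ℕ → ℝ
  | 0 => x
  | n + 1 => ω n (orbit ω x n)

/-- Every point can be moved arbitrarily far to the left and to the right, in some common number
of steps, with non-zero probability. -/
def Shiftable (μ : ProbabilityMeasure HomeoPlus) : Prop :=
  ∀ x a : ℝ, ∃ k : ℕ,
    law μ {ω | orbit ω x k < x - a} ≠ 0 ∧ law μ {ω | orbit ω x k > x + a} ≠ 0

/-- `φ₊(x)`: the probability that the iterations of `x` tend to `+∞`. -/
noncomputable def phiPlus (μ : ProbabilityMeasure HomeoPlus) (x : ℝ) : ℝ :=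
  (law μ).real {ω | Tendsto (orbit ω x) atTop atTop}

/-- `φ₋(x)`: the probability that the iterations of `x` tend to `-∞`. -/
noncomputable def phiMinus (μ : ProbabilityMeasure HomeoPlus) (x : ℝ) : ℝ :=
  (law μ).real {ω | Tendsto (orbit ω x) atTop atBot}

/-- `φ₀(x) = 1 - φ₊(x) - φ₋(x)`. -/
noncomputable def phiZero (μ : ProbabilityMeasure HomeoPlus) (x : ℝ) : ℝ :=
  1 - phiPlus μ x - phiMinus μ x

end RDS

namespace RDS

open Set Topology

/-! Two facts carry the proof.

Dichotomy (`Accessible.phiZero_dichotomy`): by Lévy's zero-one law, φ₊(F_n x) and φ₋(F_n x) converge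
almost surely to the indicators of escape to +∞ and to -∞. Shiftability makes an orbit that escapes
to neither end return infinitely often above and below every level. Along such an orbit both limits
are 0, and monotonicity of φ₊ and φ₋ then forces both to vanish everywhere. Hence φ₀ is identically
0 or identically 1.

Duality (`law_lt_orbit_eq`): reversing the order of i.i.d. factors does not change the law of their
product, so P(y < F_n x) for μ equals P(F_n y < x) for the inverse measure. If φ₀ vanishes for both
measures, n → ∞ gives equality of φ₊(x) and the inverse φ₋(y) for all x and y. Both are then
constant, and the constant is 0 or 1: case 1.

If φ₀ vanishes for exactly one of the measures, its φ₊ is either constant, hence 0 or 1 (case 2 up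
to reflection), or not constant (case 4). If it vanishes for neither, case 3 holds. -/

theorem measurable_apply : Measurable (fun p : HomeoPlus × ℝ => p.1 p.2) := by
  refine measurable_of_Ioi fun c => ?_
  have h : (fun p : HomeoPlus × ℝ => p.1 p.2) ⁻¹' Ioi c
      -- A rational between `p.1.symm c` and `p.2` reduces joint measurability to countably many
      -- evaluations.
      = ⋃ q : ℚ, {p : HomeoPlus × ℝ | c < p.1 q ∧ (q : ℝ) < p.2} := by
    ext p
    simp only [mem_preimage, mem_Ioi, mem_iUnion, mem_ofPred_eq]
    constructor
    · intro hc
      obtain ⟨q, hq₁, hq₂⟩ := exists_rat_btwn ((p.1.symm_apply_lt (x := p.2) (y := c)).2 hc)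
      exact ⟨q, (p.1.symm_apply_lt).1 hq₁, hq₂⟩
    · rintro ⟨q, hq₁, hq₂⟩
      exact hq₁.trans (p.1.strictMono hq₂)
  rw [h]
  refine MeasurableSet.iUnion fun q => ?_
  exact (measurableSet_lt measurable_const ((measurable_eval q).comp measurable_fst)).inter
    (measurableSet_lt measurable_const measurable_snd)

theorem measurable_orbit_prod (n : ℕ) :
    Measurable (fun p : (ℕ → HomeoPlus) × ℝ => orbit p.1 p.2 n) := by
  induction n with
  | zero => exact measurable_snd
  | succ n ih =>
    exact measurable_apply.comp
      (((measurable_pi_apply n).comp measurable_fst).prodMk ih)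

theorem measurable_orbit (x : ℝ) (n : ℕ) : Measurable (fun ω => orbit ω x n) :=
  (measurable_orbit_prod n).comp (measurable_id.prodMk measurable_const)

theorem orbit_mono (ω : ℕ → HomeoPlus) (n : ℕ) : Monotone (fun x => orbit ω x n) := by
  induction n with
  | zero => exact monotone_id
  | succ n ih => exact (ω n).monotone.comp ih

/-! ### Splicing and the Markov property -/

/-- The sequence consisting of the first `n` terms of `ω` followed by `η`. -/
def splice {α : Type*} (n : ℕ) (ω η : ℕ → α) : ℕ → α :=
  fun i => if i < n then ω i else η (i - n)

theorem measurable_splice {α : Type*} [MeasurableSpace α] (n : ℕ) :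
    Measurable (fun p : (ℕ → α) × (ℕ → α) => splice n p.1 p.2) := by
  refine measurable_pi_lambda _ fun i => ?_
  by_cases h : i < n
  · simp only [splice, h, if_true]
    exact (measurable_pi_apply i).comp measurable_fst
  · simp only [splice, h, if_false]
    exact (measurable_pi_apply (i - n)).comp measurable_snd

theorem orbit_splice (n : ℕ) (ω η : ℕ → HomeoPlus) (x : ℝ) (m : ℕ) :
    orbit (splice n ω η) x (n + m) = orbit η (orbit ω x n) m := by
  induction m with
  | zero =>
    have h : ∀ k ≤ n, orbit (splice n ω η) x k = orbit ω x k := by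
      intro k
      induction k with
      | zero => intro _; rfl
      | succ k ih =>
        intro hk
        simp [orbit, ih (by omega), splice, show k < n by omega]
    exact h n le_rfl
  | succ m ih => simp [orbit, ih, splice]

instance (μ : ProbabilityMeasure HomeoPlus) : IsProbabilityMeasure (law μ) := by
  unfold law; infer_instance

theorem map_splice_law (μ : ProbabilityMeasure HomeoPlus) (n : ℕ) :
    ((law μ).prod (law μ)).map (fun p => splice n p.1 p.2) = law μ := by
  refine Measure.eq_infinitePi _ fun s t ht => ?_
  rw [Measure.map_apply (measurable_splice n) (.pi s.countable_toSet fun _ _ => ht _)]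
  -- The preimage of a box is a product of boxes: indices below `n` constrain the first sequence,
  -- the others, shifted by `n`, the second.
  have h : (fun p : (ℕ → HomeoPlus) × (ℕ → HomeoPlus) => splice n p.1 p.2) ⁻¹' ((s : Set ℕ).pi t)
      = ((s.filter (· < n) : Finset ℕ) : Set ℕ).pi t ×ˢ
        (((s.filter (¬ · < n)).image (· - n) : Finset ℕ) : Set ℕ).pi (fun j => t (j + n)) := by
    ext p
    simp only [mem_preimage, Set.mem_pi, mem_prod, Finset.mem_coe, Finset.mem_filter,
      Finset.mem_image, splice]
    constructor
    · intro hp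
      refine ⟨fun i hi => by simpa [hi.2] using hp i hi.1, ?_⟩
      rintro _ ⟨i, hi, rfl⟩
      have := hp i hi.1
      rw [if_neg hi.2] at this
      rwa [Nat.sub_add_cancel (not_lt.1 hi.2)]
    · intro hp i hi
      by_cases hin : i < n
      · simpa [hin] using hp.1 i ⟨hi, hin⟩
      · have := hp.2 (i - n) ⟨i, ⟨hi, hin⟩, rfl⟩
        rw [Nat.sub_add_cancel (not_lt.1 hin)] at this
        simpa [hin] using this
  rw [h, Measure.prod_prod, law, Measure.infinitePi_pi _ fun i _ => ht i,
    Measure.infinitePi_pi _ fun j _ => ht (j + n), Finset.prod_image,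
    ← Finset.prod_filter_mul_prod_filter_not s (· < n)]
  · congr 1
    refine Finset.prod_congr rfl fun i hi => ?_
    rw [Nat.sub_add_cancel (not_lt.1 (Finset.mem_filter.1 hi).2)]
  · intro i hi j hj hij
    have hi' := (Finset.mem_filter.1 hi).2
    have hj' := (Finset.mem_filter.1 hj).2
    simp only at hij
    omega

theorem law_apply_splice (μ : ProbabilityMeasure HomeoPlus) (n : ℕ) {S : Set (ℕ → HomeoPlus)}
    (hS : MeasurableSet S) :
    law μ S = ∫⁻ ω, law μ {η | splice n ω η ∈ S} ∂(law μ) := by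
  conv_lhs => rw [← map_splice_law μ n]
  rw [Measure.map_apply (measurable_splice n) hS,
    Measure.prod_apply (measurable_splice n hS)]
  rfl

theorem law_apply_splice_symm (μ : ProbabilityMeasure HomeoPlus) (n : ℕ)
    {S : Set (ℕ → HomeoPlus)} (hS : MeasurableSet S) :
    law μ S = ∫⁻ η, law μ {ω | splice n ω η ∈ S} ∂(law μ) := by
  conv_lhs => rw [← map_splice_law μ n]
  rw [Measure.map_apply (measurable_splice n) hS,
    Measure.prod_apply_symm (measurable_splice n hS)]
  rfl

/-! ### Conditioning on the first coordinates -/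

/-- The sequence `ω` with all terms after the first `n` replaced by the identity. -/
def truncate (n : ℕ) (ω : ℕ → HomeoPlus) : ℕ → HomeoPlus :=
  splice n ω fun _ => OrderIso.refl ℝ

theorem measurable_truncate (n : ℕ) : Measurable (truncate n) :=
  (measurable_splice n).comp (measurable_id.prodMk measurable_const)

theorem truncate_splice (n : ℕ) (ω η : ℕ → HomeoPlus) :
    truncate n (splice n ω η) = truncate n ω := by
  funext i
  by_cases hi : i < n <;> simp [truncate, splice, hi]

theorem splice_truncate (n : ℕ) (ω η : ℕ → HomeoPlus) :
    splice n (truncate n ω) η = splice n ω η := by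
  funext i
  by_cases hi : i < n <;> simp [truncate, splice, hi]

theorem truncate_comp_truncate {n m : ℕ} (hnm : n ≤ m) :
    truncate n ∘ truncate m = truncate n := by
  funext ω i
  by_cases hi : i < n
  · simp [truncate, splice, hi, hi.trans_le hnm]
  · simp [truncate, splice, hi]

/-- The σ-algebras generated by the first `n` coordinates. -/
def firstCoords : Filtration ℕ (MeasurableSpace.pi : MeasurableSpace (ℕ → HomeoPlus)) where
  seq n := MeasurableSpace.comap (truncate n) MeasurableSpace.pi
  mono' n m hnm := by
    refine Measurable.comap_le ?_
    rw [← truncate_comp_truncate hnm]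
    exact (measurable_truncate n).comp (comap_measurable _)
  le' n := (measurable_truncate n).comap_le

theorem measurable_truncate_firstCoords (n : ℕ) :
    Measurable[firstCoords n] (truncate n) :=
  comap_measurable _

theorem iSup_firstCoords :
    ⨆ n, firstCoords n = (MeasurableSpace.pi : MeasurableSpace (ℕ → HomeoPlus)) := by
  refine le_antisymm (iSup_le firstCoords.le) (iSup_le fun i => ?_)
  refine le_trans ?_ (le_iSup _ (i + 1))
  have h : (fun ω : ℕ → HomeoPlus => ω i) = (fun ω => ω i) ∘ truncate (i + 1) := by
    funext ω
    simp [truncate, splice]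
  refine Measurable.comap_le ?_
  rw [h]
  exact (measurable_pi_apply i).comp (measurable_truncate_firstCoords (i + 1))

theorem measurable_law_splice (μ : ProbabilityMeasure HomeoPlus) (n : ℕ)
    {S : Set (ℕ → HomeoPlus)} (hS : MeasurableSet S) :
    Measurable (fun ω => law μ {η | splice n ω η ∈ S}) :=
  measurable_measure_prodMk_left (measurable_splice n hS)

/-- An event of `firstCoords n` is a preimage under `truncate n`, so it sees only the first argument
of a splice, and Fubini gives the defining identity of conditional expectation. -/
theorem condExp_firstCoords (μ : ProbabilityMeasure HomeoPlus) (n : ℕ)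
    {S : Set (ℕ → HomeoPlus)} (hS : MeasurableSet S) :
    (fun ω => (law μ).real {η | splice n ω η ∈ S})
      =ᵐ[law μ] (law μ)[S.indicator (fun _ => (1 : ℝ)) | firstCoords n] := by
  have hmeas : Measurable (fun ω => (law μ).real {η | splice n ω η ∈ S}) :=
    (measurable_law_splice μ n hS).ennreal_toReal
  have hint : Integrable (fun ω => (law μ).real {η | splice n ω η ∈ S}) (law μ) :=
    Integrable.of_bound hmeas.aestronglyMeasurable 1
      (Eventually.of_forall fun ω => by
        rw [Real.norm_of_nonneg measureReal_nonneg]; exact measureReal_le_one)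
  refine ae_eq_condExp_of_forall_setIntegral_eq (firstCoords.le n)
    ((integrable_const _).indicator hS) (fun s _ _ => hint.integrableOn) ?_ ?_
  · intro A hA _
    have hA' := firstCoords.le n A hA
    obtain ⟨A', -, rfl⟩ := MeasurableSpace.measurableSet_comap.1 hA
    have key : ∫⁻ ω in truncate n ⁻¹' A',
        law μ {η | splice n ω η ∈ S} ∂(law μ)
        = law μ (truncate n ⁻¹' A' ∩ S) := by
      rw [law_apply_splice μ n (hA'.inter hS), ← lintegral_indicator hA']
      refine lintegral_congr fun ω => ?_
      by_cases hω : truncate n ω ∈ A'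
      · rw [indicator_of_mem (by exact hω)]
        simp [truncate_splice, hω]
      · rw [indicator_of_notMem (by exact hω)]
        simp [truncate_splice, hω]
    rw [integral_indicator hS, integral_const, Measure.restrict_restrict hS, inter_comm]
    simp only [smul_eq_mul, mul_one, measureReal_restrict_apply_univ]
    rw [measureReal_def, ← key, ← integral_toReal]
    · rfl
    · exact (measurable_law_splice μ n hS).aemeasurable
    · exact Eventually.of_forall fun ω => measure_lt_top _ _
  · refine StronglyMeasurable.aestronglyMeasurable (Measurable.stronglyMeasurable ?_)
    have h : (fun ω => (law μ).real {η | splice n ω η ∈ S})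
        = (fun ω => (law μ).real {η | splice n ω η ∈ S}) ∘ truncate n := by
      funext ω
      simp [splice_truncate]
    rw [h]
    exact hmeas.comp (measurable_truncate_firstCoords n)

/-- Lévy's zero-one law for the product space. -/
theorem tendsto_law_splice (μ : ProbabilityMeasure HomeoPlus) {S : Set (ℕ → HomeoPlus)}
    (hS : MeasurableSet S) :
    ∀ᵐ ω ∂(law μ), Tendsto (fun n => (law μ).real {η | splice n ω η ∈ S}) atTop
      (𝓝 (S.indicator (fun _ => (1 : ℝ)) ω)) := by
  have h := tendsto_ae_condExp (μ := law μ) (ℱ := firstCoords) (S.indicator fun _ => (1 : ℝ))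
  rw [iSup_firstCoords, condExp_of_stronglyMeasurable le_rfl
    (stronglyMeasurable_const.indicator hS) ((integrable_const _).indicator hS)] at h
  filter_upwards [h, ae_all_iff.2 fun n => condExp_firstCoords μ n hS] with ω h₁ h₂
  exact h₁.congr fun n => (h₂ n).symm

theorem measurableSet_tendsto_atTop (x : ℝ) :
    MeasurableSet {ω : ℕ → HomeoPlus | Tendsto (orbit ω x) atTop atTop} :=
  measurableSet_tendsto atTop (measurable_orbit x)

theorem measurableSet_tendsto_atBot (x : ℝ) :
    MeasurableSet {ω : ℕ → HomeoPlus | Tendsto (orbit ω x) atTop atBot} :=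
  measurableSet_tendsto atBot (measurable_orbit x)

theorem measurableSet_lt_orbit (x y : ℝ) (n : ℕ) :
    MeasurableSet {ω : ℕ → HomeoPlus | y < orbit ω x n} :=
  measurableSet_lt measurable_const (measurable_orbit x n)

theorem measurableSet_orbit_lt (x y : ℝ) (n : ℕ) :
    MeasurableSet {ω : ℕ → HomeoPlus | orbit ω x n < y} :=
  measurableSet_lt (measurable_orbit x n) measurable_const

/-! ### The reflection -/

theorem law_map (μ : ProbabilityMeasure HomeoPlus) {r : HomeoPlus → HomeoPlus}
    (hr : Measurable r) :
    law (μ.map hr.aemeasurable) = (law μ).map (fun ω i => r (ω i)) :=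
  (Measure.infinitePi_map_pi (fun _ : ℕ => (μ : Measure HomeoPlus)) fun _ => hr).symm

theorem measurable_comp_seq {r : HomeoPlus → HomeoPlus} (hr : Measurable r) :
    Measurable (fun (ω : ℕ → HomeoPlus) i => r (ω i)) :=
  measurable_pi_lambda _ fun i => hr.comp (measurable_pi_apply i)

theorem law_reflect_apply (μ : ProbabilityMeasure HomeoPlus) {S : Set (ℕ → HomeoPlus)}
    (hS : MeasurableSet S) :
    law (reflect μ) S = law μ {ω | (fun i => reflectMap (ω i)) ∈ S} := by
  rw [reflect, law_map μ measurable_reflectMap,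
    Measure.map_apply (measurable_comp_seq measurable_reflectMap) hS]
  rfl

theorem orbit_reflect (ω : ℕ → HomeoPlus) (x : ℝ) (n : ℕ) :
    orbit (fun i => reflectMap (ω i)) x n = -orbit ω (-x) n := by
  induction n with
  | zero => simp [orbit]
  | succ n ih =>
    rw [orbit, ih, reflectMap, orbit]
    exact congrArg (fun y => -ω n y) (neg_neg _)

theorem phiPlus_reflect (μ : ProbabilityMeasure HomeoPlus) (x : ℝ) :
    phiPlus (reflect μ) x = phiMinus μ (-x) := by
  rw [phiPlus, phiMinus, measureReal_def, law_reflect_apply μ (measurableSet_tendsto_atTop x),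
    measureReal_def]
  congr 2
  ext ω
  have h : orbit (fun i => reflectMap (ω i)) x = fun n => -orbit ω (-x) n :=
    funext fun n => orbit_reflect ω x n
  simp only [mem_ofPred_eq, h, tendsto_neg_atTop_iff]

theorem phiMinus_reflect (μ : ProbabilityMeasure HomeoPlus) (x : ℝ) :
    phiMinus (reflect μ) x = phiPlus μ (-x) := by
  rw [phiPlus, phiMinus, measureReal_def, law_reflect_apply μ (measurableSet_tendsto_atBot x),
    measureReal_def]
  congr 2
  ext ω
  have h : orbit (fun i => reflectMap (ω i)) x = fun n => -orbit ω (-x) n :=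
    funext fun n => orbit_reflect ω x n
  simp only [mem_ofPred_eq, h, tendsto_neg_atBot_iff]

theorem phiZero_reflect (μ : ProbabilityMeasure HomeoPlus) (x : ℝ) :
    phiZero (reflect μ) x = phiZero μ (-x) := by
  rw [phiZero, phiPlus_reflect, phiMinus_reflect, phiZero]
  ring

theorem map_map_eq {μ : ProbabilityMeasure HomeoPlus} {r s : HomeoPlus → HomeoPlus}
    (hr : Measurable r) (hs : Measurable s) :
    (μ.map hr.aemeasurable).map hs.aemeasurable = μ.map (hs.comp hr).aemeasurable :=
  Subtype.ext (Measure.map_map hs hr)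

theorem inverse_inverse (μ : ProbabilityMeasure HomeoPlus) : inverse (inverse μ) = μ :=
  (map_map_eq measurable_inverseMap measurable_inverseMap).trans (Subtype.ext Measure.map_id)

theorem inverse_reflect (μ : ProbabilityMeasure HomeoPlus) :
    inverse (reflect μ) = reflect (inverse μ) :=
  (map_map_eq measurable_reflectMap measurable_inverseMap).trans
    (map_map_eq measurable_inverseMap measurable_reflectMap).symm

/-! ### Duality between the forward and the inverse dynamics -/

/-- The event y < F_n(x) says F_n⁻¹(y) < x, and F_n⁻¹ composes the inverse maps in the opposite
order. The induction therefore peels off the last map of the forward orbit, which acts as the first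
map of the inverse orbit. -/
theorem law_lt_orbit_eq (μ : ProbabilityMeasure HomeoPlus) (n : ℕ) (x y : ℝ) :
    law μ {ω | y < orbit ω x n} = law (inverse μ) {ω | orbit ω y n < x} := by
  induction n generalizing x y with
  | zero => by_cases h : y < x <;> simp [orbit, h]
  | succ n ih =>
    have hmeas : Measurable fun ω : ℕ → HomeoPlus =>
        law (inverse μ) {η | orbit η (ω 0 y) n < x} := by
      refine measurable_measure_prodMk_left
        (s := {p : (ℕ → HomeoPlus) × (ℕ → HomeoPlus) | orbit p.2 (p.1 0 y) n < x}) ?_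
      refine measurableSet_lt ((measurable_orbit_prod n).comp
        (measurable_snd.prodMk ?_)) measurable_const
      exact (measurable_eval y).comp ((measurable_pi_apply 0).comp measurable_fst)
    calc law μ {ω | y < orbit ω x (n + 1)}
        = ∫⁻ η, law μ {ω | y < orbit (splice n ω η) x (n + 1)} ∂(law μ) :=
          law_apply_splice_symm μ n (measurableSet_lt_orbit x y (n + 1))
      _ = ∫⁻ η, law (inverse μ) {ω | orbit ω (inverseMap (η 0) y) n < x} ∂(law μ) := by
          refine lintegral_congr fun η => ?_
          rw [← ih]
          congr 1
          ext ω
          rw [mem_ofPred_eq, mem_ofPred_eq, orbit_splice]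
          exact (η 0).symm_apply_lt.symm
      _ = ∫⁻ ω, law (inverse μ) {η | orbit η (ω 0 y) n < x} ∂(law (inverse μ)) := by
          have hlaw := law_map μ measurable_inverseMap
          rw [← inverse] at hlaw
          refine (lintegral_map hmeas (measurable_comp_seq measurable_inverseMap)).symm.trans ?_
          rw [← hlaw]
      _ = ∫⁻ ω, law (inverse μ) {η | orbit (splice 1 ω η) y (n + 1) < x} ∂(law (inverse μ)) := by
          refine lintegral_congr fun ω => ?_
          congr 1
          ext η
          rw [mem_ofPred_eq, mem_ofPred_eq, add_comm n 1, orbit_splice]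
          rfl
      _ = law (inverse μ) {ω | orbit ω y (n + 1) < x} :=
          (law_apply_splice (inverse μ) 1 (measurableSet_orbit_lt y x (n + 1))).symm

theorem law_orbit_lt_eq (μ : ProbabilityMeasure HomeoPlus) (n : ℕ) (x y : ℝ) :
    law μ {ω | orbit ω x n < y} = law (inverse μ) {ω | x < orbit ω y n} := by
  rw [law_lt_orbit_eq, inverse_inverse]

/-! ### Recurrence -/

/-- Every point can be moved past any other one, in either direction, with positive probability. -/
def Accessible (μ : ProbabilityMeasure HomeoPlus) : Prop :=
  ∀ x y : ℝ, (∃ k, law μ {ω | y < orbit ω x k} ≠ 0) ∧ ∃ k, law μ {ω | orbit ω x k < y} ≠ 0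

theorem Shiftable.accessible {μ : ProbabilityMeasure HomeoPlus} (h : Shiftable μ) :
    Accessible μ := by
  intro x y
  obtain ⟨k, -, hk⟩ := h x (y - x)
  obtain ⟨l, hl, -⟩ := h x (x - y)
  exact ⟨⟨k, by simpa using hk⟩, ⟨l, by simpa using hl⟩⟩

/-- Duality exchanges moving from y below x with moving from x above y under the inverse dynamics.
-/
theorem Accessible.inverse {μ : ProbabilityMeasure HomeoPlus} (h : Accessible μ) :
    Accessible (inverse μ) := by
  intro x y
  obtain ⟨k, hk⟩ := (h y x).2
  obtain ⟨l, hl⟩ := (h y x).1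
  exact ⟨⟨k, by rwa [← law_orbit_lt_eq]⟩, ⟨l, by rwa [← law_lt_orbit_eq]⟩⟩

theorem law_reflect_lt (μ : ProbabilityMeasure HomeoPlus) (x y : ℝ) (n : ℕ) :
    law (reflect μ) {ω | y < orbit ω x n} = law μ {ω | orbit ω (-x) n < -y} := by
  rw [law_reflect_apply μ (measurableSet_lt_orbit x y n)]
  simp only [mem_ofPred_eq, orbit_reflect, lt_neg]

theorem law_reflect_gt (μ : ProbabilityMeasure HomeoPlus) (x y : ℝ) (n : ℕ) :
    law (reflect μ) {ω | orbit ω x n < y} = law μ {ω | -y < orbit ω (-x) n} := by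
  rw [law_reflect_apply μ (measurableSet_orbit_lt x y n)]
  simp only [mem_ofPred_eq, orbit_reflect, neg_lt]

theorem Accessible.reflect {μ : ProbabilityMeasure HomeoPlus} (h : Accessible μ) :
    Accessible (reflect μ) := by
  intro x y
  obtain ⟨k, hk⟩ := (h (-x) (-y)).2
  obtain ⟨l, hl⟩ := (h (-x) (-y)).1
  exact ⟨⟨k, by rwa [law_reflect_lt]⟩, ⟨l, by rwa [law_reflect_gt]⟩⟩

theorem measurableSet_exists_ge_lt_orbit (x B : ℝ) (N : ℕ) :
    MeasurableSet {ω : ℕ → HomeoPlus | ∃ m ≥ N, B < orbit ω x m} := by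
  have h : {ω : ℕ → HomeoPlus | ∃ m ≥ N, B < orbit ω x m}
      = ⋃ m, ⋃ _ : m ≥ N, {ω | B < orbit ω x m} := by
    ext ω
    simp
  rw [h]
  exact .iUnion fun m => .iUnion fun _ => measurableSet_lt_orbit x B m

/-- Almost surely an orbit that stays below `B` from some time on tends to `-∞`. -/
theorem Accessible.ae_exists_or_tendsto {μ : ProbabilityMeasure HomeoPlus} (h : Accessible μ)
    (x B : ℝ) (N : ℕ) :
    ∀ᵐ ω ∂(law μ), (∃ m ≥ N, B < orbit ω x m) ∨ Tendsto (orbit ω x) atTop atBot := by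
  filter_upwards [tendsto_law_splice μ (measurableSet_exists_ge_lt_orbit x B N)] with ω hω
  by_cases hmem : ∃ m ≥ N, B < orbit ω x m
  · exact Or.inl hmem
  right
  rw [indicator_of_notMem (s := {ω | ∃ m ≥ N, B < orbit ω x m}) hmem] at hω
  refine tendsto_atBot.2 fun A => ?_
  -- From any point at or above `A`, monotonicity bounds below the chance of exceeding `B` after `k`
  -- steps by the chance from `A`. The conditional probabilities tend to 0, so the orbit is
  -- eventually below `A`.
  obtain ⟨k, hk⟩ := (h A B).1
  have hpos : 0 < (law μ).real {η | B < orbit η A k} :=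
    ENNReal.toReal_pos hk (measure_ne_top _ _)
  filter_upwards [hω.eventually (gt_mem_nhds hpos), eventually_ge_atTop N] with n hn hN
  by_contra! hA
  refine hn.not_ge (measureReal_mono fun η hη => ?_)
  refine ⟨n + k, by omega, ?_⟩
  rw [orbit_splice]
  exact lt_of_lt_of_le hη (orbit_mono η k hA.le)

theorem Accessible.ae_frequently_or_tendsto {μ : ProbabilityMeasure HomeoPlus}
    (h : Accessible μ) (x : ℝ) :
    ∀ᵐ ω ∂(law μ), (∀ B, ∃ᶠ n in atTop, B < orbit ω x n) ∨ Tendsto (orbit ω x) atTop atBot := by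
  have h' := ae_all_iff.2 fun B : ℕ => ae_all_iff.2 fun N => h.ae_exists_or_tendsto x B N
  filter_upwards [h'] with ω hω
  by_cases hbot : Tendsto (orbit ω x) atTop atBot
  · exact Or.inr hbot
  refine Or.inl fun B => frequently_atTop.2 fun N => ?_
  obtain ⟨C, hC⟩ := exists_nat_gt B
  obtain ⟨m, hm, hlt⟩ := (hω C N).resolve_right hbot
  exact ⟨m, hm, hC.trans hlt⟩

theorem Accessible.ae_frequently_or_tendsto' {μ : ProbabilityMeasure HomeoPlus}
    (h : Accessible μ) (x : ℝ) :
    ∀ᵐ ω ∂(law μ), (∀ B, ∃ᶠ n in atTop, orbit ω x n < B) ∨ Tendsto (orbit ω x) atTop atTop := by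
  have h' := h.reflect.ae_frequently_or_tendsto (-x)
  rw [RDS.reflect, law_map μ measurable_reflectMap] at h'
  filter_upwards [ae_of_ae_map (measurable_comp_seq measurable_reflectMap).aemeasurable h']
    with ω hω
  have ho : orbit (fun i => reflectMap (ω i)) (-x) = fun n => -orbit ω x n :=
    funext fun n => by rw [orbit_reflect, neg_neg]
  rw [ho, tendsto_neg_atBot_iff] at hω
  refine hω.imp_left fun hB B => (hB (-B)).mono fun n hn => ?_
  exact neg_lt_neg_iff.1 hn

/-! ### The functions `φ₊`, `φ₋` and `φ₀` -/

theorem tendsto_orbit_splice_iff (n : ℕ) (ω η : ℕ → HomeoPlus) (x : ℝ) (l : Filter ℝ) :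
    Tendsto (orbit (splice n ω η) x) atTop l ↔ Tendsto (orbit η (orbit ω x n)) atTop l := by
  rw [← tendsto_add_atTop_iff_nat n]
  refine tendsto_congr fun m => ?_
  rw [add_comm, orbit_splice]

/-- Escape is a tail event, so its conditional probability after n steps is φ₊ of the current
position. -/
theorem ae_tendsto_phiPlus (μ : ProbabilityMeasure HomeoPlus) (x : ℝ) :
    ∀ᵐ ω ∂(law μ), Tendsto (fun n => phiPlus μ (orbit ω x n)) atTop
      (𝓝 ({ω | Tendsto (orbit ω x) atTop atTop}.indicator (fun _ => (1 : ℝ)) ω)) := by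
  have h := tendsto_law_splice μ (measurableSet_tendsto_atTop x)
  simp only [mem_ofPred_eq, tendsto_orbit_splice_iff] at h
  exact h

theorem ae_tendsto_phiMinus (μ : ProbabilityMeasure HomeoPlus) (x : ℝ) :
    ∀ᵐ ω ∂(law μ), Tendsto (fun n => phiMinus μ (orbit ω x n)) atTop
      (𝓝 ({ω | Tendsto (orbit ω x) atTop atBot}.indicator (fun _ => (1 : ℝ)) ω)) := by
  have h := tendsto_law_splice μ (measurableSet_tendsto_atBot x)
  simp only [mem_ofPred_eq, tendsto_orbit_splice_iff] at h
  exact h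

theorem monotone_phiPlus (μ : ProbabilityMeasure HomeoPlus) : Monotone (phiPlus μ) :=
  fun _ _ hxy => measureReal_mono fun ω hω =>
    tendsto_atTop_mono (fun n => orbit_mono ω n hxy) hω

theorem antitone_phiMinus (μ : ProbabilityMeasure HomeoPlus) : Antitone (phiMinus μ) :=
  fun _ _ hxy => measureReal_mono fun ω hω =>
    tendsto_atBot_mono (fun n => orbit_mono ω n hxy) hω

theorem disjoint_tendsto (x : ℝ) :
    Disjoint {ω : ℕ → HomeoPlus | Tendsto (orbit ω x) atTop atTop}
      {ω | Tendsto (orbit ω x) atTop atBot} :=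
  Set.disjoint_left.2 fun _ h₁ h₂ => h₁.not_tendsto disjoint_atTop_atBot h₂

theorem phiZero_eq (μ : ProbabilityMeasure HomeoPlus) (x : ℝ) :
    phiZero μ x = (law μ).real ({ω | Tendsto (orbit ω x) atTop atTop} ∪
      {ω | Tendsto (orbit ω x) atTop atBot})ᶜ := by
  rw [probReal_compl_eq_one_sub
      ((measurableSet_tendsto_atTop x).union (measurableSet_tendsto_atBot x)),
    measureReal_union (disjoint_tendsto x) (measurableSet_tendsto_atBot x), phiZero, phiPlus,
    phiMinus]
  ring

theorem ae_tendsto_of_phiZero_eq_zero {μ : ProbabilityMeasure HomeoPlus} {x : ℝ}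
    (h : phiZero μ x = 0) :
    ∀ᵐ ω ∂(law μ), Tendsto (orbit ω x) atTop atTop ∨ Tendsto (orbit ω x) atTop atBot := by
  rw [phiZero_eq, measureReal_eq_zero_iff] at h
  exact h

theorem Accessible.phiZero_eq_one {μ : ProbabilityMeasure HomeoPlus} (h : Accessible μ) {x : ℝ}
    (hx : phiZero μ x ≠ 0) (y : ℝ) : phiZero μ y = 1 := by
  have hfreq : ∃ᶠ ω in ae (law μ),
      ¬ (Tendsto (orbit ω x) atTop atTop ∨ Tendsto (orbit ω x) atTop atBot) := by
    intro hcon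
    refine hx ?_
    rw [phiZero_eq, measureReal_eq_zero_iff]
    simp only [not_not] at hcon
    exact hcon
  -- Non-escape has positive probability, so some non-escaping path satisfies all the almost sure
  -- properties at once.
  obtain ⟨ω, hω, hup, hdown, hplus, hminus⟩ := (hfreq.and_eventually
    ((h.ae_frequently_or_tendsto x).and ((h.ae_frequently_or_tendsto' x).and
      ((ae_tendsto_phiPlus μ x).and (ae_tendsto_phiMinus μ x))))).exists
  rw [not_or] at hω
  rw [indicator_of_notMem hω.1] at hplus
  rw [indicator_of_notMem hω.2] at hminus
  have hp : phiPlus μ y ≤ 0 := ge_of_tendsto_of_frequently hplus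
    ((hup.resolve_right hω.2 y).mono fun n hn => monotone_phiPlus μ hn.le)
  have hm : phiMinus μ y ≤ 0 := ge_of_tendsto_of_frequently hminus
    ((hdown.resolve_right hω.1 y).mono fun n hn => antitone_phiMinus μ hn.le)
  rw [phiZero, hp.antisymm measureReal_nonneg, hm.antisymm measureReal_nonneg]
  norm_num

theorem Accessible.phiZero_dichotomy {μ : ProbabilityMeasure HomeoPlus} (h : Accessible μ) :
    (∀ x, phiZero μ x = 0) ∨ ∀ x, phiZero μ x = 1 := by
  by_cases hx : ∀ x, phiZero μ x = 0
  · exact Or.inl hx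
  · obtain ⟨x, hx⟩ := not_forall.1 hx
    exact Or.inr (h.phiZero_eq_one hx)

theorem eq_zero_or_one_of_phiPlus_const {μ : ProbabilityMeasure HomeoPlus} {c : ℝ}
    (h : ∀ x, phiPlus μ x = c) : c = 0 ∨ c = 1 := by
  obtain ⟨ω, hω⟩ := (ae_tendsto_phiPlus μ 0).exists
  simp only [h] at hω
  have hc := tendsto_nhds_unique hω tendsto_const_nhds
  by_cases hmem : ω ∈ {ω | Tendsto (orbit ω 0) atTop atTop}
  · rw [indicator_of_mem hmem] at hc
    exact Or.inr hc.symm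
  · rw [indicator_of_notMem hmem] at hc
    exact Or.inl hc.symm

/-- Almost every orbit escapes, so the indicators converge almost surely and the limit does not
depend on the level y. -/
theorem tendsto_law_lt_orbit {μ : ProbabilityMeasure HomeoPlus} {x : ℝ} (h : phiZero μ x = 0)
    (y : ℝ) :
    Tendsto (fun n => (law μ).real {ω | y < orbit ω x n}) atTop (𝓝 (phiPlus μ x)) := by
  refine (ENNReal.tendsto_toReal (measure_ne_top _ _)).comp
    (tendsto_measure_of_ae_tendsto_indicator_of_isFiniteMeasure atTop
      (measurableSet_tendsto_atTop x) (measurableSet_lt_orbit x y) ?_)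
  filter_upwards [ae_tendsto_of_phiZero_eq_zero h] with ω hω
  rcases hω with hω | hω
  · filter_upwards [hω.eventually_gt_atTop y] with n hn
    exact iff_of_true hn hω
  · filter_upwards [hω.eventually_lt_atBot y] with n hn
    exact iff_of_false hn.not_gt fun h' => h'.not_tendsto disjoint_atTop_atBot hω

theorem tendsto_law_orbit_lt {μ : ProbabilityMeasure HomeoPlus} {x : ℝ} (h : phiZero μ x = 0)
    (y : ℝ) :
    Tendsto (fun n => (law μ).real {ω | orbit ω x n < y}) atTop (𝓝 (phiMinus μ x)) := by
  have h' : phiZero (reflect μ) (-x) = 0 := by rw [phiZero_reflect, neg_neg, h]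
  have := tendsto_law_lt_orbit h' (-y)
  rw [phiPlus_reflect, neg_neg] at this
  refine this.congr fun n => ?_
  rw [measureReal_def, law_reflect_lt, neg_neg, neg_neg, measureReal_def]

theorem phiPlus_eq_phiMinus_inverse {μ : ProbabilityMeasure HomeoPlus} {x y : ℝ}
    (hx : phiZero μ x = 0) (hy : phiZero (inverse μ) y = 0) :
    phiPlus μ x = phiMinus (inverse μ) y := by
  refine tendsto_nhds_unique (tendsto_law_lt_orbit hx y)
    ((tendsto_law_orbit_lt hy x).congr fun n => ?_)
  rw [measureReal_def, measureReal_def, law_lt_orbit_eq]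

/-- The classification when the orbits of `μ` tend to infinity and those of the inverse dynamics
oscillate. -/
theorem classification_of_phiZero {μ : ProbabilityMeasure HomeoPlus}
    (h₀ : ∀ x, phiZero μ x = 0) (h₁ : ∀ x, phiZero (inverse μ) x = 1) :
    (∀ x, phiPlus μ x = 1) ∨
      ((∀ x, phiPlus (reflect μ) x = 1) ∧ ∀ x, phiZero (inverse (reflect μ)) x = 1) ∨
      ((¬ ∃ c : ℝ, ∀ x, phiPlus μ x = c) ∧ ¬ ∃ c : ℝ, ∀ x, phiMinus μ x = c) := by
  have hsum : ∀ x, phiMinus μ x = 1 - phiPlus μ x := fun x => by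
    have := h₀ x
    rw [phiZero] at this
    linarith
  by_cases hc : ∃ c : ℝ, ∀ x, phiPlus μ x = c
  · obtain ⟨c, hc⟩ := hc
    rcases eq_zero_or_one_of_phiPlus_const hc with rfl | rfl
    · refine Or.inr (Or.inl ⟨fun x => ?_, fun x => ?_⟩)
      · rw [phiPlus_reflect, hsum, hc, sub_zero]
      · rw [inverse_reflect, phiZero_reflect, h₁]
    · exact Or.inl hc
  · refine Or.inr (Or.inr ⟨hc, fun ⟨c, hc'⟩ => hc ⟨1 - c, fun x => ?_⟩⟩)
    rw [← hc' x, hsum, sub_sub_cancel]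

end RDS

theorem theorem3 (μ : ProbabilityMeasure RDS.HomeoPlus) (hμ : RDS.Shiftable μ) :
    ∃ ν : ProbabilityMeasure RDS.HomeoPlus,
      (ν = μ ∨ ν = RDS.inverse μ ∨ ν = RDS.reflect μ ∨ ν = RDS.reflect (RDS.inverse μ)) ∧
      (((∀ x, RDS.phiPlus ν x = 1) ∧ (∀ x, RDS.phiMinus (RDS.inverse ν) x = 1)) ∨
       ((∀ x, RDS.phiPlus ν x = 1) ∧ (∀ x, RDS.phiZero (RDS.inverse ν) x = 1)) ∨
       ((∀ x, RDS.phiZero ν x = 1) ∧ (∀ x, RDS.phiZero (RDS.inverse ν) x = 1)) ∨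
       ((∀ x, RDS.phiZero ν x = 0) ∧
        (¬ ∃ c : ℝ, ∀ x, RDS.phiPlus ν x = c) ∧ (¬ ∃ c : ℝ, ∀ x, RDS.phiMinus ν x = c) ∧
        (∀ x, RDS.phiZero (RDS.inverse ν) x = 1))) := by
  open RDS in
  have hacc := hμ.accessible
  rcases hacc.phiZero_dichotomy with h | h <;> rcases hacc.inverse.phiZero_dichotomy with h' | h'
  · have hconst : ∀ x y, phiPlus μ x = phiMinus (inverse μ) y := fun x y =>
      phiPlus_eq_phiMinus_inverse (h x) (h' y)
    have hplus : ∀ x, phiPlus μ x = phiPlus μ 0 := fun x =>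
      (hconst x 0).trans (hconst 0 0).symm
    rcases eq_zero_or_one_of_phiPlus_const hplus with h0 | h1
    -- With φ₊ = 0, μ drifts to -∞ and its inverse to +∞, so exchanging the two measures suffices
    -- without a reflection.
    · refine ⟨inverse μ, Or.inr (Or.inl rfl), Or.inl ⟨fun x => ?_, fun x => ?_⟩⟩
      · have := h' x
        rw [phiZero, ← hconst 0 x, h0] at this
        linarith
      · have := h x
        rw [phiZero, hplus x, h0] at this
        rw [inverse_inverse]
        linarith
    · exact ⟨μ, Or.inl rfl, Or.inl ⟨fun x => (hplus x).trans h1,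
        fun y => (hconst 0 y).symm.trans h1⟩⟩
  · rcases classification_of_phiZero h h' with hp | hr | hn
    · exact ⟨μ, Or.inl rfl, Or.inr (Or.inl ⟨hp, h'⟩)⟩
    · exact ⟨reflect μ, Or.inr (Or.inr (Or.inl rfl)), Or.inr (Or.inl hr)⟩
    · exact ⟨μ, Or.inl rfl, Or.inr (Or.inr (Or.inr ⟨h, hn.1, hn.2, h'⟩))⟩
  · have hi : ∀ x, phiZero (inverse (inverse μ)) x = 1 := by rwa [inverse_inverse]
    rcases classification_of_phiZero h' hi with hp | hr | hn
    · exact ⟨inverse μ, Or.inr (Or.inl rfl), Or.inr (Or.inl ⟨hp, hi⟩)⟩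
    · exact ⟨reflect (inverse μ), Or.inr (Or.inr (Or.inr rfl)), Or.inr (Or.inl hr)⟩
    · exact ⟨inverse μ, Or.inr (Or.inl rfl), Or.inr (Or.inr (Or.inr ⟨h', hn.1, hn.2, hi⟩))⟩
  · exact ⟨μ, Or.inl rfl, Or.inr (Or.inr (Or.inl ⟨h, h'⟩))⟩
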